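/- **Lemma (Well-posedness), continuous bilinear form $a_{n,\theta}$.** Let $d\in\{2,3\}$ and let $D\subset\mathbb R^d$ be a bounded open set (for instance a bounded, simply connected Lipschitz domain). Let $d_*=1$ if $d=2$ and $d_*=3$ if $d=3$. For $\vec v\in\mathbb R^d$ and $\vec b\in\mathbb R^{d_*}$ let $\vec v\times\vec b$ be the usual cross product if $d=3$, and $\vec v\times\vec b=(v_2,-v_1)^T\,b$ if $d=2$. Let $\rho^n\in L^\infty(D)$ be a density with $\rho^n\ge 0$ almost everywhere, let $\vec\Omega:D\to\mathbb R^{d_*}$ be a measurable field, and let $\alpha,\tau_n,\theta>0$. For $x\in D$ put $$\mathcal B_{n,\theta}\vec v=\vec v-\theta\tau_n\,\vec v\times\vec\Omega(x),\qquad \vec v\in\mathbb R^d,$$ which is an invertible linear map of $\mathbb R^d$, and for $\varphi,\psi\in H^1(D)$ define $$a_{n,\theta}(\varphi,\psi)=(\nabla\varphi,\nabla\psi)_{L^2(D)^d}+\theta^2\tau_n^2\alpha\,\big(\rho^n\mathcal B_{n,\theta}^{-1}\nabla\varphi,\nabla\psi\big)_{L^2(D)^d}.$$ Let $\omega_p=\sqrt{\rho^n\alpha}$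 be the plasma frequency and $\bar\omega_p=\|\omega_p\|_{L^\infty(D)}$. Then the integrals defining $a_{n,\theta}$ converge, $a_{n,\theta}$ is a continuous bilinear form on $H^1(D)$, and the following hold. 1. (Coercivity.) $a_{n,\theta}(\varphi,\varphi)\ge\|\nabla\varphi\|_{L^2(D)^d}^2$ for all $\varphi\in H^1(D)$. Moreover there is a constant $\kappa>0$ that depends only on $D$, and not on $\rho^n,\vec\Omega,\alpha,\tau_n,\theta$, such that $a_{n,\theta}(\varphi,\varphi)\ge\kappa\,\|\varphi\|_{H^1(D)}^2$ for all $\varphi\in H^1_0(D)$. 2. (Boundedness.) For all $\varphi,\psi\in H^1(D)$, $$|a_{n,\theta}(\varphi,\psi)|\le\big(1+\theta^2\tau_n^2\bar\omega_p^2\big)\,\|\nabla\varphi\|_{L^2(D)^d}\,\|\nabla\psi\|_{L^2(D)^d}.$$ In particular the norm $C$ of $a_{n,\theta}$ as a bilinear form on $H^1(D)$, that is, the smallest constant $C\ge0$ with $|a_{n,\theta}(\varphi,\psi)|\le C\|\varphi\|_{H^1(D)}\|\psi\|_{H^1(D)}$ for all $\varphi,\psi\in H^1(D)$, satisfies $C\le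 1+\theta^2\tau_n^2\bar\omega_p^2$. Hence $C\le(1+\theta^2)\,\tau_n^2\bar\omega_p^2$ whenever $\tau_n\bar\omega_p\ge 1$, that is, $C=\mathcal O(\tau_n^2\bar\omega_p^2)$, uniformly in $\vec\Omega$. Here $H^1(D)$ consists of the functions in $L^2(D)$ with weak gradient in $L^2(D)^d$, with $\|\varphi\|_{H^1(D)}^2=\|\varphi\|_{L^2(D)}^2+\|\nabla\varphi\|_{L^2(D)^d}^2$, and $H^1_0(D)$ is the closure of $C_c^\infty(D)$ in $H^1(D)$. -/

import Mathlib

open MeasureTheory TopologicalSpace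
open scoped ENNReal Distributions

namespace EulerPoisson

noncomputable section

/-- Euclidean space `ℝ^d`. -/
abbrev Space (d : ℕ) : Type := EuclideanSpace ℝ (Fin d)

/-- The number `d_*` of components of the magnetic field: `d_* = 1` for `d = 2` (transverse
magnetic configuration, the field is perpendicular to the plane) and `d_* = d` otherwise. -/
def fieldDim : ℕ → ℕ
  | 2 => 1
  | d => d

/-- The product `v × b` of a velocity `v ∈ ℝ^d` and a magnetic field value `b ∈ ℝ^{d_*}`: it is
`(v₂ b, -v₁ b)` for `d = 2` and the usual cross product for `d = 3`. Other dimensions are not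
used. -/
def magCross : (d : ℕ) → Space d → Space (fieldDim d) → Space d
  | 2, v, b => !₂[v 1 * b (0 : Fin 1), -(v 0 * b (0 : Fin 1))]
  | 3, v, b => WithLp.toLp 2 (crossProduct (WithLp.ofLp v) (WithLp.ofLp b))
  | _, _, _ => 0

theorem magCross_add (d : ℕ) (v w : Space d) (b : Space (fieldDim d)) :
    magCross d (v + w) b = magCross d v b + magCross d w b := by
  match d, v, w, b with
  | 2, v, w, b => ext i; fin_cases i <;> simp [magCross] <;> ring
  | 3, v, w, b => simp [magCross]
  | 0, _, _, _ | 1, _, _, _ | (n + 4), _, _, _ => simp [magCross]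

theorem magCross_smul (d : ℕ) (c : ℝ) (v : Space d) (b : Space (fieldDim d)) :
    magCross d (c • v) b = c • magCross d v b := by
  match d, v, b with
  | 2, v, b => ext i; fin_cases i <;> simp [magCross] <;> ring
  | 3, v, b => simp [magCross]
  | 0, _, _ | 1, _, _ | (n + 4), _, _ => simp [magCross]

theorem inner_magCross_self (d : ℕ) (v : Space d) (b : Space (fieldDim d)) :
    inner ℝ (magCross d v b) v = 0 := by
  match d, v, b with
  | 2, v, b => simp [magCross, PiLp.inner_apply, Fin.sum_univ_two]; ring
  | 3, v, b =>
    have : ∀ i : Fin 3, (magCross 3 v b) i =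
        (crossProduct (WithLp.ofLp v) (WithLp.ofLp b)) i := fun _ => rfl
    simp only [PiLp.inner_apply, Fin.sum_univ_three, this, cross_apply]
    simp
    ring
  | 0, _, _ | 1, _, _ | (n + 4), _, _ => simp [magCross]

/-- The linear map `𝓑 v = v - s (v × b)` on `ℝ^d`; in the scheme, `s = θ τ` and `b = Ω(x)`. -/
def magB {d : ℕ} (s : ℝ) (b : Space (fieldDim d)) : Space d →ₗ[ℝ] Space d where
  toFun v := v - s • magCross d v b
  map_add' v w := by rw [magCross_add, smul_add]; abel
  map_smul' c v := by rw [magCross_smul, smul_comm s c, RingHom.id_apply, smul_sub]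

theorem magB_injective {d : ℕ} (s : ℝ) (b : Space (fieldDim d)) :
    Function.Injective (magB (d := d) s b) := by
  rw [injective_iff_map_eq_zero]
  intro v hv
  have h : inner ℝ (v - s • magCross d v b) v = 0 := by
    have : v - s • magCross d v b = 0 := hv
    rw [this, inner_zero_left]
  rw [inner_sub_left, real_inner_smul_left, inner_magCross_self, mul_zero, sub_zero] at h
  exact inner_self_eq_zero.mp h

/-- The inverse `𝓑⁻¹` of `𝓑`, which is injective on a finite-dimensional space. -/
def magBInv {d : ℕ} (s : ℝ) (b : Space (fieldDim d)) : Space d →ₗ[ℝ] Space d :=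
  (LinearEquiv.ofInjectiveEndo (magB s b) (magB_injective s b)).symm.toLinearMap

/-- Lebesgue measure on `D`. -/
abbrev volD {d : ℕ} (D : Opens (Space d)) : Measure (Space d) :=
  (volume : Measure (Space d)).restrict (D : Set (Space d))

/-- `L²(D; F)`. -/
abbrev L2 {d : ℕ} (D : Opens (Space d)) (F : Type) [NormedAddCommGroup F] : Type :=
  Lp F 2 (volD D)

/-- `g ∈ L²(D; ℝ^d)` is the weak gradient of `u ∈ L²(D)`. -/
def IsWeakGradient {d : ℕ} (D : Opens (Space d)) (u : L2 D ℝ) (g : L2 D (Space d)) : Prop :=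
  ∀ (η : 𝓓(D, ℝ)) (v : Space d),
    ∫ x, u x * fderiv ℝ η x v ∂(volD D) = -∫ x, inner ℝ (g x) v * η x ∂(volD D)

theorem integrable_mul_fderiv {d : ℕ} (D : Opens (Space d)) (u : L2 D ℝ) (η : 𝓓(D, ℝ))
    (v : Space d) : Integrable (fun x => u x * fderiv ℝ η x v) (volD D) := by
  have hc : Continuous (fun x => fderiv ℝ η x v) :=
    (η.contDiff.continuous_fderiv (by simp)).clm_apply continuous_const
  have hs : HasCompactSupport (fun x => fderiv ℝ η x v) := η.hasCompactSupport.fderiv_apply ℝ v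
  exact (Lp.memLp u).integrable_mul (q := 2) ((hc.memLp_of_hasCompactSupport hs).restrict _)

theorem integrable_inner_mul {d : ℕ} (D : Opens (Space d)) (g : L2 D (Space d)) (η : 𝓓(D, ℝ))
    (v : Space d) : Integrable (fun x => inner ℝ (g x) v * η x) (volD D) :=
  ((Lp.memLp g).inner_const v).integrable_mul (q := 2)
    ((η.continuous.memLp_of_hasCompactSupport η.hasCompactSupport).restrict _)

theorem IsWeakGradient.zero {d : ℕ} (D : Opens (Space d)) : IsWeakGradient D 0 0 := by
  intro η v
  have h1 : (fun x => (0 : L2 D ℝ) x * fderiv ℝ η x v) =ᵐ[volD D] fun _ => 0 := by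
    filter_upwards [Lp.coeFn_zero ℝ 2 (volD D)] with x hx
    rw [hx, Pi.zero_apply, zero_mul]
  have h2 : (fun x => inner ℝ ((0 : L2 D (Space d)) x) v * η x) =ᵐ[volD D] fun _ => 0 := by
    filter_upwards [Lp.coeFn_zero (Space d) 2 (volD D)] with x hx
    rw [hx, Pi.zero_apply, inner_zero_left, zero_mul]
  rw [integral_congr_ae h1, integral_congr_ae h2]
  simp

theorem IsWeakGradient.add {d : ℕ} {D : Opens (Space d)} {u u' : L2 D ℝ}
    {g g' : L2 D (Space d)} (h : IsWeakGradient D u g) (h' : IsWeakGradient D u' g') :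
    IsWeakGradient D (u + u') (g + g') := by
  intro η v
  have h1 : (fun x => (u + u') x * fderiv ℝ η x v) =ᵐ[volD D]
      fun x => u x * fderiv ℝ η x v + u' x * fderiv ℝ η x v := by
    filter_upwards [Lp.coeFn_add u u'] with x hx
    rw [hx, Pi.add_apply, add_mul]
  have h2 : (fun x => inner ℝ ((g + g') x) v * η x) =ᵐ[volD D]
      fun x => inner ℝ (g x) v * η x + inner ℝ (g' x) v * η x := by
    filter_upwards [Lp.coeFn_add g g'] with x hx
    rw [hx, Pi.add_apply, inner_add_left, add_mul]
  rw [integral_congr_ae h1, integral_congr_ae h2,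
    integral_add (integrable_mul_fderiv D u η v) (integrable_mul_fderiv D u' η v),
    integral_add (integrable_inner_mul D g η v) (integrable_inner_mul D g' η v), h η v, h' η v]
  ring

theorem IsWeakGradient.smul {d : ℕ} {D : Opens (Space d)} {u : L2 D ℝ}
    {g : L2 D (Space d)} (c : ℝ) (h : IsWeakGradient D u g) :
    IsWeakGradient D (c • u) (c • g) := by
  intro η v
  have h1 : (fun x => (c • u) x * fderiv ℝ η x v) =ᵐ[volD D]
      fun x => c * (u x * fderiv ℝ η x v) := by
    filter_upwards [Lp.coeFn_smul c u] with x hx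
    rw [hx, Pi.smul_apply, smul_eq_mul, mul_assoc]
  have h2 : (fun x => inner ℝ ((c • g) x) v * η x) =ᵐ[volD D]
      fun x => c * (inner ℝ (g x) v * η x) := by
    filter_upwards [Lp.coeFn_smul c g] with x hx
    rw [hx, Pi.smul_apply, real_inner_smul_left, mul_assoc]
  rw [integral_congr_ae h1, integral_congr_ae h2, integral_const_mul, integral_const_mul, h η v]
  ring

/-- The pairs of a function in `L²(D)` and its weak gradient in `L²(D; ℝ^d)`, as a subspace of
the Hilbert sum `L²(D) ⊕ L²(D; ℝ^d)`. -/
def weakGradientGraph {d : ℕ} (D : Opens (Space d)) :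
    Submodule ℝ (WithLp 2 (L2 D ℝ × L2 D (Space d))) where
  carrier := {p | IsWeakGradient D p.fst p.snd}
  zero_mem' := IsWeakGradient.zero D
  add_mem' h h' := h.add h'
  smul_mem' c _ h := h.smul c

/-- The Sobolev space `H¹(D)`: the functions in `L²(D)` that have a weak gradient in
`L²(D; ℝ^d)`, each stored together with this (unique) gradient. Its norm is
`‖φ‖² = ‖φ‖²_{L²} + ‖∇φ‖²_{L²}`, see `H1.norm_sq`. -/
def H1 {d : ℕ} (D : Opens (Space d)) : Type := weakGradientGraph D

instance {d : ℕ} (D : Opens (Space d)) : NormedAddCommGroup (H1 D) :=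
  inferInstanceAs (NormedAddCommGroup (weakGradientGraph D))

instance {d : ℕ} (D : Opens (Space d)) : InnerProductSpace ℝ (H1 D) :=
  inferInstanceAs (InnerProductSpace ℝ (weakGradientGraph D))

/-- The underlying `L²` function of an element of `H¹(D)`. -/
def H1.fn {d : ℕ} {D : Opens (Space d)} (φ : H1 D) : L2 D ℝ := φ.1.fst

/-- The weak gradient `∇φ ∈ L²(D; ℝ^d)` of `φ ∈ H¹(D)`. -/
def H1.grad {d : ℕ} {D : Opens (Space d)} (φ : H1 D) : L2 D (Space d) := φ.1.snd

theorem H1.norm_sq {d : ℕ} {D : Opens (Space d)} (φ : H1 D) :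
    ‖φ‖ ^ 2 = ‖φ.fn‖ ^ 2 + ‖φ.grad‖ ^ 2 :=
  WithLp.prod_norm_sq_eq_of_L2 (α := L2 D ℝ) (β := L2 D (Space d)) φ.1

/-- `H¹₀(D)`: the closure in `H¹(D)` of the smooth functions with compact support in `D`. -/
def H10 {d : ℕ} (D : Opens (Space d)) : Submodule ℝ (H1 D) :=
  (Submodule.span ℝ {φ : H1 D | ∃ η : 𝓓(D, ℝ), φ.fn =ᵐ[volD D] η}).topologicalClosure

/-- The integrand `ρ 𝓑⁻¹∇φ · ∇ψ`, where `𝓑 = 𝓑(x)` has the parameters `s = θ τ` and `Ω(x)`. -/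
def couplingIntegrand {d : ℕ} {D : Opens (Space d)} (ρ : Space d → ℝ)
    (Ω : Space d → Space (fieldDim d)) (τ θ : ℝ) (φ ψ : H1 D) (x : Space d) : ℝ :=
  inner ℝ (ρ x • magBInv (θ * τ) (Ω x) (φ.grad x)) (ψ.grad x)

/-- The form `a(φ, ψ) = (∇φ, ∇ψ)_{L²} + θ² τ² α (ρ 𝓑⁻¹∇φ, ∇ψ)_{L²}`. -/
def formA {d : ℕ} {D : Opens (Space d)} (ρ : Space d → ℝ)
    (Ω : Space d → Space (fieldDim d)) (α τ θ : ℝ) (φ ψ : H1 D) : ℝ :=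
  (∫ x, inner ℝ (φ.grad x) (ψ.grad x) ∂(volD D)) +
    θ ^ 2 * τ ^ 2 * α * ∫ x, couplingIntegrand ρ Ω τ θ φ ψ x ∂(volD D)

/-- The pointwise plasma frequency `√(ρ α)`. -/
def plasmaFreq {d : ℕ} (ρ : Space d → ℝ) (α : ℝ) (x : Space d) : ℝ := √(ρ x * α)

/-- The maximal plasma frequency `‖√(ρ α)‖_{L^∞(D)}`. -/
def maxPlasmaFreq {d : ℕ} (D : Opens (Space d)) (ρ : Space d → ℝ) (α : ℝ) : ℝ :=
  (eLpNorm (plasmaFreq ρ α) ∞ (volD D)).toReal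

end

end EulerPoisson

open Filter Topology

namespace EulerPoisson

noncomputable section

/-! ### The pointwise inverse `𝓑⁻¹` -/

/-! The magnetic force does no work: `v × b ⊥ v`, so `𝓑v · v = |v|²`. Substituting `v = 𝓑⁻¹w` gives
`𝓑⁻¹w · w = |𝓑⁻¹w|²` (`inner_magBInv_self`), hence `|𝓑⁻¹w| ≤ |w|` by Cauchy–Schwarz
(`norm_magBInv_le`), for every field value. The identity makes the coupling term nonnegative on the
diagonal, which is coercivity in the gradient seminorm. The contraction, with `ρα ≤ ω̄²` a.e., gives
the bound uniform in `Ω`, and also the continuity of `𝓑⁻¹` in the field, hence measurability of the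
integrand.

Coercivity on `H¹₀(D)` then needs only a Poincaré inequality whose constant depends on a radius `R`
of a ball containing `D` (`norm_fn_le_of_mem_H10`). It comes from testing the weak gradient of `φ`
against `x_i φ` for `φ` equal to a test function, then passing to the closure. -/

theorem magB_apply {d : ℕ} (s : ℝ) (b : Space (fieldDim d)) (v : Space d) :
    magB s b v = v - s • magCross d v b := rfl

theorem magB_magBInv {d : ℕ} (s : ℝ) (b : Space (fieldDim d)) (w : Space d) :
    magB s b (magBInv s b w) = w :=
  (LinearEquiv.ofInjectiveEndo (magB s b) (magB_injective s b)).apply_symm_apply w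

theorem magBInv_magB {d : ℕ} (s : ℝ) (b : Space (fieldDim d)) (v : Space d) :
    magBInv s b (magB s b v) = v :=
  (LinearEquiv.ofInjectiveEndo (magB s b) (magB_injective s b)).symm_apply_apply v

theorem inner_magB_self {d : ℕ} (s : ℝ) (b : Space (fieldDim d)) (v : Space d) :
    inner ℝ (magB s b v) v = ‖v‖ ^ 2 := by
  rw [magB_apply, inner_sub_left, real_inner_smul_left, inner_magCross_self, mul_zero, sub_zero,
    real_inner_self_eq_norm_sq]

theorem inner_magBInv_self {d : ℕ} (s : ℝ) (b : Space (fieldDim d)) (w : Space d) :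
    inner ℝ (magBInv s b w) w = ‖magBInv s b w‖ ^ 2 := by
  rw [← inner_magB_self s b, magB_magBInv, real_inner_comm]

/-- Cauchy–Schwarz in `inner_magBInv_self`. The constant 1 is independent of `s` and `b`, the source
of all uniformity in `Ω`. -/
theorem norm_magBInv_le {d : ℕ} (s : ℝ) (b : Space (fieldDim d)) (w : Space d) :
    ‖magBInv s b w‖ ≤ ‖w‖ := by
  have h := real_inner_le_norm (magBInv s b w) w
  rw [inner_magBInv_self, sq] at h
  rcases (norm_nonneg (magBInv s b w)).eq_or_lt with h0 | h0
  · rw [← h0]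
    exact norm_nonneg w
  · exact le_of_mul_le_mul_left h h0

theorem continuous_magCross_right {d : ℕ} (hd : d = 2 ∨ d = 3) (v : Space d) :
    Continuous fun b => magCross d v b := by
  rcases hd with rfl | rfl
  · refine (PiLp.continuous_toLp 2 _).comp (continuous_pi fun i => ?_)
    fin_cases i
    · exact continuous_const.mul (PiLp.continuous_apply 2 _ (0 : Fin 1))
    · exact (continuous_const.mul (PiLp.continuous_apply 2 _ (0 : Fin 1))).neg
  · refine (PiLp.continuous_toLp 2 _).comp ?_
    exact (LinearMap.continuous_of_finiteDimensional (crossProduct (WithLp.ofLp v))).comp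
      (PiLp.continuous_ofLp 2 _)

/-- `𝓑⁻¹` depends continuously on the magnetic field and on the vector jointly. -/
theorem continuous_magBInv {d : ℕ} (hd : d = 2 ∨ d = 3) (s : ℝ) :
    Continuous fun p : Space (fieldDim d) × Space d => magBInv s p.1 p.2 := by
  rw [continuous_iff_continuousAt]
  rintro ⟨b₀, w₀⟩
  set v₀ := magBInv s b₀ w₀ with hv₀
  have hc : Continuous fun p : Space (fieldDim d) × Space d => ‖p.2 - magB s p.1 v₀‖ := by
    simp only [magB_apply]
    exact (continuous_snd.sub (continuous_const.sub
      (((continuous_magCross_right hd v₀).comp continuous_fst).const_smul s))).norm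
  have h0 : Tendsto (fun p : Space (fieldDim d) × Space d => ‖p.2 - magB s p.1 v₀‖)
      (𝓝 (b₀, w₀)) (𝓝 0) := by
    have := hc.tendsto (b₀, w₀)
    simpa [hv₀, magB_magBInv] using this
  rw [ContinuousAt, tendsto_iff_norm_sub_tendsto_zero]
  refine squeeze_zero (fun _ => norm_nonneg _) (fun p => ?_) h0
  -- With `v₀` frozen, the error is the inverse applied to the residual `w - 𝓑 v₀`. The contraction
  -- is uniform in `b`, so continuity of `𝓑 v₀` in `b` suffices.
  calc ‖magBInv s p.1 p.2 - v₀‖ = ‖magBInv s p.1 (p.2 - magB s p.1 v₀)‖ := by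
        rw [map_sub, magBInv_magB]
    _ ≤ _ := norm_magBInv_le _ _ _

/-! ### Pairings of fields dominated by `L²` fields -/

section Pairing

variable {X F G : Type*} [MeasurableSpace X] {μ : Measure X} [NormedAddCommGroup F]
  [InnerProductSpace ℝ F] [NormedAddCommGroup G]

theorem integrable_inner_of_ae_norm_le_mul {f : X → F} {M : ℝ} (g : Lp G 2 μ) (h : Lp F 2 μ)
    (hf : AEStronglyMeasurable f μ) (hfg : ∀ᵐ x ∂μ, ‖f x‖ ≤ M * ‖g x‖) :
    Integrable (fun x => inner ℝ (f x) (h x)) μ := by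
  have hm := (Lp.memLp g).of_le_mul hf hfg
  refine (L2.integrable_inner (𝕜 := ℝ) (hm.toLp f) h).congr ?_
  filter_upwards [hm.coeFn_toLp] with x hx
  rw [hx]

theorem abs_integral_inner_le_of_ae_norm_le_mul {f : X → F} {M : ℝ} (g : Lp G 2 μ)
    (h : Lp F 2 μ) (hf : AEStronglyMeasurable f μ) (hfg : ∀ᵐ x ∂μ, ‖f x‖ ≤ M * ‖g x‖) :
    |∫ x, inner ℝ (f x) (h x) ∂μ| ≤ M * ‖g‖ * ‖h‖ := by
  have hm := (Lp.memLp g).of_le_mul hf hfg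
  have h1 : ∫ x, inner ℝ (f x) (h x) ∂μ = inner ℝ (hm.toLp f) h := by
    rw [L2.inner_def]
    refine integral_congr_ae ?_
    filter_upwards [hm.coeFn_toLp] with x hx
    rw [hx]
  have h2 : ‖hm.toLp f‖ ≤ M * ‖g‖ := by
    refine Lp.norm_le_mul_norm_of_ae_le_mul ?_
    filter_upwards [hm.coeFn_toLp, hfg] with x hx hx'
    rwa [hx]
  rw [h1]
  exact (abs_real_inner_le_norm _ _).trans (mul_le_mul_of_nonneg_right h2 (norm_nonneg h))

end Pairing

/-! ### The Poincaré inequality on `H¹₀(D)` -/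

/-- The product of a test function with a linear functional. -/
def mulTest {d : ℕ} {D : Opens (Space d)} (l : Space d →L[ℝ] ℝ) (η : 𝓓(D, ℝ)) : 𝓓(D, ℝ) where
  toFun x := l x * η x
  contDiff' := l.contDiff.mul η.contDiff
  hasCompactSupport' := η.hasCompactSupport.mul_left
  tsupport_subset' := (tsupport_mul_subset_right (f := l) (g := η)).trans η.tsupport_subset

theorem mulTest_apply {d : ℕ} {D : Opens (Space d)} (l : Space d →L[ℝ] ℝ) (η : 𝓓(D, ℝ))
    (x : Space d) : mulTest l η x = l x * η x := rfl

/-- Moves the integrals to the whole space, where integration by parts has no boundary term. -/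
theorem setIntegral_test_mul {d : ℕ} {D : Opens (Space d)} (η : 𝓓(D, ℝ)) (f : Space d → ℝ) :
    ∫ x, η x * f x ∂(volD D) = ∫ x, η x * f x :=
  setIntegral_eq_integral_of_forall_compl_eq_zero fun x hx => by
    rw [image_eq_zero_of_notMem_tsupport fun h => hx (η.tsupport_subset h), zero_mul]

theorem continuous_fderiv_test {d : ℕ} {D : Opens (Space d)} (η : 𝓓(D, ℝ)) (v : Space d) :
    Continuous fun x => fderiv ℝ η x v :=
  (η.contDiff.continuous_fderiv (by simp)).clm_apply continuous_const

theorem integrable_test_mul {d : ℕ} {D : Opens (Space d)} (η : 𝓓(D, ℝ)) {f : Space d → ℝ}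
    (hf : Continuous f) : Integrable fun x => η x * f x :=
  (η.continuous.mul hf).integrable_of_hasCompactSupport η.hasCompactSupport.mul_right

theorem differentiable_test {d : ℕ} {D : Opens (Space d)} (η : 𝓓(D, ℝ)) : Differentiable ℝ η :=
  η.contDiff.differentiable (by simp)

theorem fderiv_mulTest {d : ℕ} {D : Opens (Space d)} (l : Space d →L[ℝ] ℝ) (η : 𝓓(D, ℝ))
    (x v : Space d) : fderiv ℝ (mulTest l η) x v = l x * fderiv ℝ η x v + η x * l v := by
  have h := l.hasFDerivAt.mul (differentiable_test η x).hasFDerivAt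
  have h' : fderiv ℝ (mulTest l η) x = _ := h.fderiv
  rw [h']
  simp

/-- Half of `∫ η²`, by parts. -/
theorem integral_test_mul_fderiv_mulTest {d : ℕ} {D : Opens (Space d)} (l : Space d →L[ℝ] ℝ)
    (η : 𝓓(D, ℝ)) {v : Space d} (hv : l v = 1) :
    2 * ∫ x, η x * fderiv ℝ (mulTest l η) x v = ∫ x, η x * η x := by
  have hi : Integrable fun x => η x * (l x * fderiv ℝ η x v) :=
    integrable_test_mul η (l.continuous.mul (continuous_fderiv_test η v))
  have h1 : ∫ x, η x * fderiv ℝ (mulTest l η) x v =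
      -∫ x, fderiv ℝ η x v * mulTest l η x := by
    refine integral_mul_fderiv_eq_neg_fderiv_mul_of_integrable ?_
      (integrable_test_mul η (continuous_fderiv_test _ v))
      (integrable_test_mul η (mulTest l η).continuous)
      (fun x _ => differentiable_test η x) (fun x _ => differentiable_test _ x)
    simpa only [mul_comm] using integrable_test_mul (mulTest l η) (continuous_fderiv_test η v)
  have h2 : ∫ x, η x * fderiv ℝ (mulTest l η) x v =
      (∫ x, η x * (l x * fderiv ℝ η x v)) + ∫ x, η x * η x := by
    rw [← integral_add hi (integrable_test_mul η η.continuous)]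
    refine integral_congr_ae (ae_of_all _ fun x => ?_)
    simp only [fderiv_mulTest, hv]
    ring
  have h3 : ∫ x, fderiv ℝ η x v * mulTest l η x = ∫ x, η x * (l x * fderiv ℝ η x v) :=
    integral_congr_ae (ae_of_all _ fun x => by simp only [mulTest_apply]; ring)
  -- With `J = ∫ η l ∂ᵥη`, integration by parts gives `-J` for the integral and the product rule
  -- gives `J + ∫ η²`; adding eliminates `J`.
  rw [h3] at h1
  linarith

/-- Test the weak gradient against `x_i η`: one side is `‖φ‖²/2`, the other is at most `R ‖φ‖ ‖∇φ‖`
since `|x_i| ≤ R` on `D`. There is no need to identify `∇φ` with the classical gradient of `η`. -/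
theorem norm_fn_le_of_ae_eq_test {d : ℕ} {D : Opens (Space d)} {R : ℝ}
    (hR : ∀ x ∈ D, ‖x‖ ≤ R) (hR0 : 0 ≤ R) (i : Fin d) (φ : H1 D) (η : 𝓓(D, ℝ))
    (hη : φ.fn =ᵐ[volD D] η) : ‖φ.fn‖ ≤ 2 * R * ‖φ.grad‖ := by
  set e : Space d := EuclideanSpace.single i 1 with he
  have hen : ‖e‖ = 1 := by simp [he]
  set l : Space d →L[ℝ] ℝ := innerSL ℝ e with hl
  have hle : l e = 1 := by simp [hl, he]
  have hw : IsWeakGradient D φ.fn φ.grad := φ.2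
  have h1 := hw (mulTest l η) e
  have h2 : ∫ x, φ.fn x * fderiv ℝ (mulTest l η) x e ∂(volD D) =
      ∫ x, η x * fderiv ℝ (mulTest l η) x e := by
    rw [← setIntegral_test_mul]
    refine integral_congr_ae ?_
    filter_upwards [hη] with x hx
    rw [hx]
  have h3 : ∫ x, η x * η x = ‖φ.fn‖ ^ 2 := by
    rw [← setIntegral_test_mul, ← real_inner_self_eq_norm_sq, L2.inner_def]
    refine integral_congr_ae ?_
    filter_upwards [hη] with x hx
    rw [hx, real_inner_self_eq_norm_sq, Real.norm_eq_abs, sq_abs, sq]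
  have h4 : ∫ x, inner ℝ (φ.grad x) e * mulTest l η x ∂(volD D) =
      ∫ x, inner ℝ ((l x * φ.fn x) • e) (φ.grad x) ∂(volD D) := by
    refine integral_congr_ae ?_
    filter_upwards [hη] with x hx
    rw [hx, mulTest_apply, real_inner_smul_left, real_inner_comm, mul_comm]
  have h5 : |∫ x, inner ℝ ((l x * φ.fn x) • e) (φ.grad x) ∂(volD D)| ≤
      R * ‖φ.fn‖ * ‖φ.grad‖ := by
    refine abs_integral_inner_le_of_ae_norm_le_mul φ.fn φ.grad ?_ ?_
    · exact (l.continuous.aestronglyMeasurable.mul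
        (Lp.aestronglyMeasurable φ.fn)).smul_const e
    · filter_upwards [ae_restrict_mem D.isOpen.measurableSet] with x hx
      rw [norm_smul, hen, mul_one, norm_mul]
      refine mul_le_mul_of_nonneg_right ?_ (norm_nonneg _)
      calc ‖l x‖ ≤ ‖e‖ * ‖x‖ := norm_inner_le_norm e x
        _ ≤ R := by rw [hen, one_mul]; exact hR x hx
  have h6 := integral_test_mul_fderiv_mulTest l η hle
  rw [h2, h4] at h1
  rw [h1, h3] at h6
  have h7 : ‖φ.fn‖ * ‖φ.fn‖ ≤ ‖φ.fn‖ * (2 * R * ‖φ.grad‖) := by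
    nlinarith [neg_le_of_abs_le h5]
  rcases (norm_nonneg φ.fn).eq_or_lt with h0 | h0
  · rw [← h0]
    positivity
  · exact le_of_mul_le_mul_left h7 h0

/-! ### Function and gradient as continuous linear maps on `H¹(D)` -/

theorem H1.fn_add {d : ℕ} {D : Opens (Space d)} (φ ψ : H1 D) : (φ + ψ).fn = φ.fn + ψ.fn := rfl

theorem H1.fn_smul {d : ℕ} {D : Opens (Space d)} (c : ℝ) (φ : H1 D) :
    (c • φ).fn = c • φ.fn := rfl

theorem H1.grad_add {d : ℕ} {D : Opens (Space d)} (φ ψ : H1 D) :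
    (φ + ψ).grad = φ.grad + ψ.grad := rfl

theorem H1.grad_smul {d : ℕ} {D : Opens (Space d)} (c : ℝ) (φ : H1 D) :
    (c • φ).grad = c • φ.grad := rfl

theorem H1.norm_grad_le {d : ℕ} {D : Opens (Space d)} (φ : H1 D) : ‖φ.grad‖ ≤ ‖φ‖ := by
  refine abs_le_of_sq_le_sq' ?_ (norm_nonneg φ) |>.2
  rw [H1.norm_sq]
  exact le_add_of_nonneg_left (sq_nonneg _)

theorem H1.continuous_fn {d : ℕ} {D : Opens (Space d)} : Continuous (H1.fn (D := D)) :=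
  (WithLp.prod_continuous_ofLp 2 (L2 D ℝ) (L2 D (Space d))).fst.comp continuous_subtype_val

theorem H1.continuous_grad {d : ℕ} {D : Opens (Space d)} : Continuous (H1.grad (D := D)) :=
  (WithLp.prod_continuous_ofLp 2 (L2 D ℝ) (L2 D (Space d))).snd.comp continuous_subtype_val

/-- Test functions already form a subspace, so taking the span adds nothing. -/
theorem exists_test_of_mem_span {d : ℕ} {D : Opens (Space d)} {φ : H1 D}
    (hφ : φ ∈ Submodule.span ℝ {φ : H1 D | ∃ η : 𝓓(D, ℝ), φ.fn =ᵐ[volD D] η}) :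
    ∃ η : 𝓓(D, ℝ), φ.fn =ᵐ[volD D] η := by
  induction hφ using Submodule.span_induction with
  | mem _ h => exact h
  | zero => exact ⟨0, Lp.coeFn_zero ℝ 2 (volD D)⟩
  | add φ ψ _ _ hφ hψ =>
    obtain ⟨η, hη⟩ := hφ
    obtain ⟨ζ, hζ⟩ := hψ
    refine ⟨η + ζ, ?_⟩
    rw [H1.fn_add]
    exact (Lp.coeFn_add _ _).trans (hη.add hζ)
  | smul c φ _ hφ =>
    obtain ⟨η, hη⟩ := hφ
    refine ⟨c • η, ?_⟩
    rw [H1.fn_smul]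
    exact (Lp.coeFn_smul _ _).trans (hη.const_smul c)

/-- The Poincaré (Friedrichs) inequality on `H¹₀(D)`, for `D` contained in a ball of radius `R`. -/
theorem norm_fn_le_of_mem_H10 {d : ℕ} {D : Opens (Space d)} {R : ℝ}
    (hR : ∀ x ∈ D, ‖x‖ ≤ R) (hR0 : 0 ≤ R) (i : Fin d) {φ : H1 D} (hφ : φ ∈ H10 D) :
    ‖φ.fn‖ ≤ 2 * R * ‖φ.grad‖ := by
  have hc : IsClosed {φ : H1 D | ‖φ.fn‖ ≤ 2 * R * ‖φ.grad‖} :=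
    isClosed_le H1.continuous_fn.norm (continuous_const.mul H1.continuous_grad.norm)
  refine closure_minimal (fun ψ hψ => ?_) hc hφ
  obtain ⟨η, hη⟩ := exists_test_of_mem_span hψ
  exact norm_fn_le_of_ae_eq_test hR hR0 i ψ η hη

/-! ### The form -/

theorem plasmaFreq_sq {d : ℕ} {ρ : Space d → ℝ} {α : ℝ} {x : Space d} (hρ : 0 ≤ ρ x)
    (hα : 0 ≤ α) : plasmaFreq ρ α x ^ 2 = ρ x * α :=
  Real.sq_sqrt (mul_nonneg hρ hα)

theorem ae_plasmaFreq_le {d : ℕ} {D : Opens (Space d)} {ρ : Space d → ℝ} {α : ℝ}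
    (hρ : MemLp ρ ∞ (volD D)) (hα : 0 ≤ α) :
    ∀ᵐ x ∂(volD D), plasmaFreq ρ α x ≤ maxPlasmaFreq D ρ α := by
  -- Finiteness is essential: `toReal` would send an infinite essential supremum to `0`.
  have hfin : eLpNorm (plasmaFreq ρ α) ∞ (volD D) ≠ ∞ := by
    have hb := eLpNormEssSup_lt_top_of_ae_bound (μ := volD D) (f := plasmaFreq ρ α)
      (C := √((eLpNorm ρ ∞ (volD D)).toReal * α)) ?_
    · rw [eLpNorm_exponent_top]
      exact hb.ne
    · filter_upwards [ae_le_eLpNormEssSup (f := ρ) (μ := volD D)] with x hx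
      rw [plasmaFreq, Real.norm_of_nonneg (Real.sqrt_nonneg _)]
      refine Real.sqrt_le_sqrt (mul_le_mul_of_nonneg_right ?_ hα)
      refine (le_abs_self _).trans ?_
      have := ENNReal.toReal_mono (hρ.2.ne) (hx.trans_eq eLpNorm_exponent_top.symm)
      rwa [toReal_enorm] at this
  filter_upwards [ae_le_eLpNormEssSup (f := plasmaFreq ρ α) (μ := volD D)] with x hx
  have := ENNReal.toReal_mono hfin (hx.trans_eq eLpNorm_exponent_top.symm)
  rw [toReal_enorm] at this
  exact (le_abs_self _).trans this

section Form

variable {d : ℕ} {D : Opens (Space d)} {ρ : Space d → ℝ} {Ω : Space d → Space (fieldDim d)}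
  {α τ θ : ℝ}

theorem aestronglyMeasurable_smul_magBInv (hd : d = 2 ∨ d = 3) (hρ : MemLp ρ ∞ (volD D))
    (hΩ : AEStronglyMeasurable Ω (volD D)) (s : ℝ) (g : L2 D (Space d)) :
    AEStronglyMeasurable (fun x => ρ x • magBInv s (Ω x) (g x)) (volD D) := by
  have h : AEStronglyMeasurable (fun x => (Ω x, g x)) (volD D) :=
    hΩ.prodMk (Lp.aestronglyMeasurable g)
  have h' : AEStronglyMeasurable (fun x => magBInv s (Ω x) (g x)) (volD D) :=
    Continuous.comp_aestronglyMeasurable (f := fun x => (Ω x, g x))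
      (g := fun p : Space (fieldDim d) × Space d => magBInv s p.1 p.2) (continuous_magBInv hd s) h
  exact hρ.1.smul h'

theorem ae_norm_smul_magBInv_le (hρ : MemLp ρ ∞ (volD D)) (hρ0 : ∀ᵐ x ∂(volD D), 0 ≤ ρ x)
    (hα : 0 < α) (s : ℝ) (g : L2 D (Space d)) :
    ∀ᵐ x ∂(volD D), ‖ρ x • magBInv s (Ω x) (g x)‖ ≤ maxPlasmaFreq D ρ α ^ 2 / α * ‖g x‖ := by
  filter_upwards [hρ0, ae_plasmaFreq_le hρ hα.le] with x hx hx'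
  rw [norm_smul, Real.norm_of_nonneg hx]
  refine mul_le_mul ?_ (norm_magBInv_le _ _ _) (norm_nonneg _) (by positivity)
  rw [le_div_iff₀ hα, ← plasmaFreq_sq hx hα.le]
  exact pow_le_pow_left₀ (Real.sqrt_nonneg _) hx' 2

theorem integrable_couplingIntegrand (hd : d = 2 ∨ d = 3) (hρ : MemLp ρ ∞ (volD D))
    (hρ0 : ∀ᵐ x ∂(volD D), 0 ≤ ρ x) (hΩ : AEStronglyMeasurable Ω (volD D)) (φ ψ : H1 D) :
    Integrable (couplingIntegrand ρ Ω τ θ φ ψ) (volD D) :=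
  integrable_inner_of_ae_norm_le_mul φ.grad ψ.grad
    (aestronglyMeasurable_smul_magBInv hd hρ hΩ (θ * τ) φ.grad)
    -- The integrand does not contain `α`, so the bound is used with `α = 1`.
    (ae_norm_smul_magBInv_le hρ hρ0 one_pos (θ * τ) φ.grad)

theorem abs_integral_couplingIntegrand_le (hd : d = 2 ∨ d = 3) (hρ : MemLp ρ ∞ (volD D))
    (hρ0 : ∀ᵐ x ∂(volD D), 0 ≤ ρ x) (hΩ : AEStronglyMeasurable Ω (volD D)) (hα : 0 < α)
    (φ ψ : H1 D) : |∫ x, couplingIntegrand ρ Ω τ θ φ ψ x ∂(volD D)| ≤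
      maxPlasmaFreq D ρ α ^ 2 / α * ‖φ.grad‖ * ‖ψ.grad‖ :=
  abs_integral_inner_le_of_ae_norm_le_mul φ.grad ψ.grad
    (aestronglyMeasurable_smul_magBInv hd hρ hΩ (θ * τ) φ.grad)
    (ae_norm_smul_magBInv_le hρ hρ0 hα (θ * τ) φ.grad)

theorem formA_eq (φ ψ : H1 D) : formA ρ Ω α τ θ φ ψ = inner ℝ φ.grad ψ.grad +
    θ ^ 2 * τ ^ 2 * α * ∫ x, couplingIntegrand ρ Ω τ θ φ ψ x ∂(volD D) := by
  rw [formA, L2.inner_def]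

theorem abs_formA_le (hd : d = 2 ∨ d = 3) (hρ : MemLp ρ ∞ (volD D))
    (hρ0 : ∀ᵐ x ∂(volD D), 0 ≤ ρ x) (hΩ : AEStronglyMeasurable Ω (volD D)) (hα : 0 < α)
    (φ ψ : H1 D) : |formA ρ Ω α τ θ φ ψ| ≤
      (1 + θ ^ 2 * (τ ^ 2 * maxPlasmaFreq D ρ α ^ 2)) * ‖φ.grad‖ * ‖ψ.grad‖ := by
  rw [formA_eq]
  calc _ ≤ ‖φ.grad‖ * ‖ψ.grad‖ + θ ^ 2 * τ ^ 2 * α *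
        (maxPlasmaFreq D ρ α ^ 2 / α * ‖φ.grad‖ * ‖ψ.grad‖) := by
        refine (abs_add_le _ _).trans (add_le_add (abs_real_inner_le_norm _ _) ?_)
        rw [abs_mul, abs_of_nonneg (by positivity : 0 ≤ θ ^ 2 * τ ^ 2 * α)]
        exact mul_le_mul_of_nonneg_left
          (abs_integral_couplingIntegrand_le hd hρ hρ0 hΩ hα φ ψ) (by positivity)
    _ = _ := by field_simp

/-- On the diagonal the coupling integrand is `ρ |𝓑⁻¹∇φ|² ≥ 0`. -/
theorem norm_grad_sq_le_formA (hρ0 : ∀ᵐ x ∂(volD D), 0 ≤ ρ x) (hα : 0 < α) (φ : H1 D) :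
    ‖φ.grad‖ ^ 2 ≤ formA ρ Ω α τ θ φ φ := by
  rw [formA_eq, real_inner_self_eq_norm_sq]
  refine le_add_of_nonneg_right (mul_nonneg (by positivity) (integral_nonneg_of_ae ?_))
  filter_upwards [hρ0] with x hx
  rw [couplingIntegrand, real_inner_smul_left, inner_magBInv_self]
  exact mul_nonneg hx (sq_nonneg _)

theorem formA_add_left (hint : ∀ φ ψ : H1 D,
    Integrable (couplingIntegrand ρ Ω τ θ φ ψ) (volD D)) (φ φ' ψ : H1 D) :
    formA ρ Ω α τ θ (φ + φ') ψ = formA ρ Ω α τ θ φ ψ + formA ρ Ω α τ θ φ' ψ := by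
  have h : ∫ x, couplingIntegrand ρ Ω τ θ (φ + φ') ψ x ∂(volD D) =
      (∫ x, couplingIntegrand ρ Ω τ θ φ ψ x ∂(volD D)) +
        ∫ x, couplingIntegrand ρ Ω τ θ φ' ψ x ∂(volD D) := by
    rw [← integral_add (hint φ ψ) (hint φ' ψ)]
    refine integral_congr_ae ?_
    filter_upwards [Lp.coeFn_add φ.grad φ'.grad] with x hx
    simp only [couplingIntegrand, H1.grad_add, hx, Pi.add_apply, map_add, smul_add,
      inner_add_left]
  rw [formA_eq, formA_eq, formA_eq, h, H1.grad_add, inner_add_left]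
  ring

theorem formA_add_right (hint : ∀ φ ψ : H1 D,
    Integrable (couplingIntegrand ρ Ω τ θ φ ψ) (volD D)) (φ ψ ψ' : H1 D) :
    formA ρ Ω α τ θ φ (ψ + ψ') = formA ρ Ω α τ θ φ ψ + formA ρ Ω α τ θ φ ψ' := by
  have h : ∫ x, couplingIntegrand ρ Ω τ θ φ (ψ + ψ') x ∂(volD D) =
      (∫ x, couplingIntegrand ρ Ω τ θ φ ψ x ∂(volD D)) +
        ∫ x, couplingIntegrand ρ Ω τ θ φ ψ' x ∂(volD D) := by
    rw [← integral_add (hint φ ψ) (hint φ ψ')]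
    refine integral_congr_ae ?_
    filter_upwards [Lp.coeFn_add ψ.grad ψ'.grad] with x hx
    simp only [couplingIntegrand, H1.grad_add, hx, Pi.add_apply, inner_add_right]
  rw [formA_eq, formA_eq, formA_eq, h, H1.grad_add, inner_add_right]
  ring

theorem formA_smul_left (c : ℝ) (φ ψ : H1 D) :
    formA ρ Ω α τ θ (c • φ) ψ = c • formA ρ Ω α τ θ φ ψ := by
  have h : ∫ x, couplingIntegrand ρ Ω τ θ (c • φ) ψ x ∂(volD D) =
      c * ∫ x, couplingIntegrand ρ Ω τ θ φ ψ x ∂(volD D) := by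
    rw [← integral_const_mul]
    refine integral_congr_ae ?_
    filter_upwards [Lp.coeFn_smul c φ.grad] with x hx
    simp only [couplingIntegrand, H1.grad_smul, hx, Pi.smul_apply, map_smul,
      real_inner_smul_left]
    ring
  rw [formA_eq, formA_eq, h, H1.grad_smul, real_inner_smul_left, smul_eq_mul]
  ring

theorem formA_smul_right (c : ℝ) (φ ψ : H1 D) :
    formA ρ Ω α τ θ φ (c • ψ) = c • formA ρ Ω α τ θ φ ψ := by
  have h : ∫ x, couplingIntegrand ρ Ω τ θ φ (c • ψ) x ∂(volD D) =
      c * ∫ x, couplingIntegrand ρ Ω τ θ φ ψ x ∂(volD D) := by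
    rw [← integral_const_mul]
    refine integral_congr_ae ?_
    filter_upwards [Lp.coeFn_smul c ψ.grad] with x hx
    simp only [couplingIntegrand, H1.grad_smul, hx, Pi.smul_apply, real_inner_smul_right]
  rw [formA_eq, formA_eq, h, H1.grad_smul, real_inner_smul_right, smul_eq_mul]
  ring

end Form

end

end EulerPoisson

/-! ### Assembly of the continuous form and its estimates -/

theorem mainTheorem8 {d : ℕ} (hd : d = 2 ∨ d = 3)
    (D : TopologicalSpace.Opens (EulerPoisson.Space d))
    (hD : Bornology.IsBounded (D : Set (EulerPoisson.Space d))) :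
    ∃ κ : ℝ, 0 < κ ∧
      ∀ (ρ : EulerPoisson.Space d → ℝ)
        (Ω : EulerPoisson.Space d → EulerPoisson.Space (EulerPoisson.fieldDim d))
        (α τ θ : ℝ),
        MeasureTheory.MemLp ρ ∞ (EulerPoisson.volD D) →
        (∀ᵐ x ∂(EulerPoisson.volD D), 0 ≤ ρ x) →
        MeasureTheory.AEStronglyMeasurable Ω (EulerPoisson.volD D) →
        0 < α → 0 < τ → 0 < θ →
        -- the second integral in the form exists
        (∀ φ ψ : EulerPoisson.H1 D, MeasureTheory.Integrable
          (EulerPoisson.couplingIntegrand ρ Ω τ θ φ ψ) (EulerPoisson.volD D)) ∧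
        -- the form is a continuous bilinear form on `H¹(D)`
        ∃ A : EulerPoisson.H1 D →L[ℝ] EulerPoisson.H1 D →L[ℝ] ℝ,
          (∀ φ ψ : EulerPoisson.H1 D, A φ ψ = EulerPoisson.formA ρ Ω α τ θ φ ψ) ∧
          -- coercivity in the gradient seminorm on `H¹(D)`
          (∀ φ : EulerPoisson.H1 D, ‖φ.grad‖ ^ 2 ≤ A φ φ) ∧
          -- coercivity in the full norm on `H¹₀(D)`
          (∀ φ ∈ EulerPoisson.H10 D, κ * ‖φ‖ ^ 2 ≤ A φ φ) ∧
          -- boundedness, with the scaling of the constant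
          (∀ φ ψ : EulerPoisson.H1 D, |A φ ψ| ≤
            (1 + θ ^ 2 * (τ ^ 2 * EulerPoisson.maxPlasmaFreq D ρ α ^ 2)) *
              ‖φ.grad‖ * ‖ψ.grad‖) ∧
          ‖A‖ ≤ 1 + θ ^ 2 * (τ ^ 2 * EulerPoisson.maxPlasmaFreq D ρ α ^ 2) ∧
          (1 ≤ τ * EulerPoisson.maxPlasmaFreq D ρ α →
            ‖A‖ ≤ (1 + θ ^ 2) * (τ ^ 2 * EulerPoisson.maxPlasmaFreq D ρ α ^ 2)) := by
  obtain ⟨R, hRpos, hR⟩ := hD.exists_pos_norm_le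
  have i : Fin d := ⟨0, by omega⟩
  -- From `‖φ‖_{L²} ≤ 2R ‖∇φ‖` one gets `‖φ‖²_{H¹} ≤ (1 + (2R)²) ‖∇φ‖²`.
  refine ⟨1 / (1 + (2 * R) ^ 2), by positivity, ?_⟩
  intro ρ Ω α τ θ hρ hρ0 hΩ hα hτ hθ
  have hint : ∀ φ ψ : EulerPoisson.H1 D, MeasureTheory.Integrable
      (EulerPoisson.couplingIntegrand ρ Ω τ θ φ ψ) (EulerPoisson.volD D) :=
    EulerPoisson.integrable_couplingIntegrand hd hρ hρ0 hΩ
  have hbound := EulerPoisson.abs_formA_le (τ := τ) (θ := θ) hd hρ hρ0 hΩ hα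
  have hcoer : ∀ φ : EulerPoisson.H1 D, ‖φ.grad‖ ^ 2 ≤ EulerPoisson.formA ρ Ω α τ θ φ φ :=
    EulerPoisson.norm_grad_sq_le_formA hρ0 hα
  set C := 1 + θ ^ 2 * (τ ^ 2 * EulerPoisson.maxPlasmaFreq D ρ α ^ 2) with hC
  have hC0 : 0 ≤ C := by positivity
  let a : EulerPoisson.H1 D →ₗ[ℝ] EulerPoisson.H1 D →ₗ[ℝ] ℝ :=
    LinearMap.mk₂ ℝ (EulerPoisson.formA ρ Ω α τ θ)
      (EulerPoisson.formA_add_left hint) EulerPoisson.formA_smul_left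
      (EulerPoisson.formA_add_right hint) EulerPoisson.formA_smul_right
  have ha : ∀ φ ψ, ‖a φ ψ‖ ≤ C * ‖φ‖ * ‖ψ‖ := fun φ ψ =>
    (hbound φ ψ).trans (mul_le_mul (mul_le_mul_of_nonneg_left φ.norm_grad_le hC0)
      ψ.norm_grad_le (norm_nonneg _) (by positivity))
  have hnorm : ‖a.mkContinuous₂ C ha‖ ≤ C := a.mkContinuous₂_norm_le hC0 ha
  refine ⟨hint, a.mkContinuous₂ C ha, fun φ ψ => rfl, hcoer, fun φ hφ => ?_, hbound, hnorm,
    fun h1 => hnorm.trans ?_⟩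
  · refine le_trans ?_ (hcoer φ)
    have hP := EulerPoisson.norm_fn_le_of_mem_H10 hR hRpos.le i hφ
    have hP2 := pow_le_pow_left₀ (norm_nonneg _) hP 2
    rw [div_mul_eq_mul_div, one_mul, div_le_iff₀ (by positivity), φ.norm_sq]
    nlinarith
  -- The leading `1` of `C` is absorbed by `1 ≤ τ² ω̄²`.
  · have h2 := one_le_pow₀ (n := 2) h1
    rw [mul_pow] at h2
    rw [hC, add_mul, one_mul]
    exact add_le_add_left h2 _
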